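/- Let $k$ be an algebraically closed field of characteristic $2$, let $f\in k[x,y,z,w]$ be one of the polynomials listed below (the left-hand label is its type), and let $X=\operatorname{Spec} R$ with $R=k[x,y,z,w]/(f)$. Then: (i) $X$ is $F$-pure if and only if the type of $f$ is one of $E_7^3F_4$, $D_4^1B_1$, $D_4^1B_2$, $D_5^1C_3$, $D_{2n}^{n-1}B_{n-1}$, $D_{2n}^{n-1}B_n$, $D_{2n}^{n-1}C_{2n-2}$, $D_{2n+1}^{n-1}B_{n-1}$, $D_{2n+1}^{n-1}C_{2n-1}$ with $n\ge 3$. (ii) $X$ is not $F$-rational. Here $R$ is $F$-pure if its Frobenius endomorphism $F:R\to R$ is pure, i.e. $M\to F_*R\otimes_R M$, $m\mapsto 1\otimes m$, is injective for every $R$-module $M$. It is $F$-rational if every ideal $I$ generated by $\operatorname{height} I$ elements is tightly closed, i.e. contains every $a\in R$ for which there is $c\in R$, in no minimal prime of $R$, with $c\,a^{q}\in I^{[q]}$ for all large powers $q$ of $2$, where $I^{[q]}$ is the ideal generated by the $q$-th powers of the elements of $I$. The list: * $E_7^3F_4$: $z^2+x^3+xy^3+xyz+wy^4$; $E_7^2F_4$: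 $z^2+x^3+xy^3+y^3z+wy^4$; $E_7^1F_4$: $z^2+x^3+xy^3+wy^4$; $E_8^3F_4$: $z^2+x^3+y^3z+wy^4$; $E_8^2F_4$: $z^2+x^3+xy^2z+wy^4$; $E_8^1F_4$: $z^2+x^3+xy^3z+wy^4$; $E_8^0F_4$: $z^2+x^3+wy^4$. * $D_4^1B_1$: $z^2+xyz+wx^2+y^3$; $D_4^1B_2$: $z^2+xy^2+xyz+wx^2$; $D_4^0B_1$: $z^2+wx^2+y^3$; $D_4^0B_2$: $z^2+xy^2+wx^2$; $D_5^1C_3$: $z^2+x^2y+y^2z+xyz+wy^3$; $D_5^0C_3$: $z^2+x^2y+y^2z+wy^3$. * For $n\ge3$ and $1\le r\le n-1$, with $\beta=r$, $\gamma=2r$ if $r>n/2$, and $\beta=\lfloor (n+1)/2\rfloor$, $\gamma=n$ if $r\le n/2$: $D_{2n}^rB_b$ ($\beta\le b\le n-1$): $z^2+xy^n+xy^{n-r}z+wx^2+y^{2b+1}$; $D_{2n}^rB_n$: $z^2+xy^n+xy^{n-r}z+wx^2$; $D_{2n}^rC_c$ ($\gamma\le c\le 2n-2$): $z^2+x^2y+xy^n+xy^{n-r}z+wy^c$.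 In addition $D_6^1B_2$: $z^2+xy^3+wx^2+y^5$ and $D_6^1B_3$: $z^2+xy^3+wx^2$. * For even $n\ge4$: $D_{2n}^0B_b$ ($n/2\le b\le n-1$): $z^2+xy^n+wx^2+y^{2b+1}$; $D_{2n}^0B_n$: $z^2+xy^n+wx^2$. * For $n\ge3$: $D_{2n}^0C_c$ ($n\le c\le 2n-2$): $z^2+x^2y+xy^n+wy^c$; in addition $D_{2n}^0C_n$: $z^2+x^2y+wy^n$. * For $n\ge3$: $D_{2n+1}^{n-1}B_{n-1}$: $z^2+xyz+wx^2+y^{2n-1}$; for $1\le r\le n-1$, $D_{2n+1}^rC_c$ ($\delta\le c\le 2n-1$, where $\delta=2r+1$ if $r>n/2$ and $\delta=n+1$ if $r\le n/2$): $z^2+x^2y+y^nz+xy^{n-r}z+wy^c$; and $D_{2n+1}^0C_c$ ($n+1\le c\le 2n-1$): $z^2+x^2y+y^nz+wy^c$. -/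

import Mathlib

open scoped TensorProduct

universe u v

/-! ### Purity of ring homomorphisms and `F`-purity -/

/-- A homomorphism `φ : R → S` of commutative rings is *pure* if for every `R`-module `M` the map
`M → S ⊗[R] M`, `m ↦ 1 ⊗ m`, is injective, where `S` is an `R`-module through `φ`.
(It suffices to test finitely generated modules, so modules in the universe of `R` are enough.) -/
def RingHom.IsPureHom {R : Type u} {S : Type v} [CommRing R] [CommRing S] (φ : R →+* S) : Prop :=
  letI : Algebra R S := φ.toAlgebra
  ∀ (M : Type u) [AddCommGroup M] [Module R M],
    Function.Injective (fun m : M => (1 : S) ⊗ₜ[R] m)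

/-- A commutative ring is *`F`-pure* (for the prime `p`) if it has characteristic `p` and its
Frobenius endomorphism `r ↦ r ^ p` is pure. -/
def IsFPure (p : ℕ) [Fact p.Prime] (R : Type u) [CommRing R] : Prop :=
  ∃ _ : CharP R p, (frobenius R p).IsPureHom

/-! ### Tight closure and `F`-rationality -/

/-- The Frobenius power `I^[q]`: the ideal generated by the `q`-th powers of the elements of `I`
(used for `q` a power of the characteristic). -/
def Ideal.frobeniusPower {R : Type u} [CommRing R] (I : Ideal R) (q : ℕ) : Ideal R :=
  Ideal.span ((fun a : R => a ^ q) '' (I : Set R))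

/-- `a` belongs to the tight closure `I^*` of `I`: there is an element `c`, outside every minimal
prime of `R`, such that `c * a ^ q ∈ I^[q]` for all sufficiently large powers `q = p ^ e`. -/
def Ideal.MemTightClosure {R : Type u} [CommRing R] (p : ℕ) (I : Ideal R) (a : R) : Prop :=
  ∃ c : R, (∀ P ∈ minimalPrimes R, c ∉ P) ∧
    ∃ N : ℕ, ∀ e ≥ N, c * a ^ p ^ e ∈ I.frobeniusPower (p ^ e)

/-- An ideal is *tightly closed* if it contains its tight closure. -/
def Ideal.IsTightlyClosed {R : Type u} [CommRing R] (p : ℕ) (I : Ideal R) : Prop :=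
  ∀ a : R, I.MemTightClosure p a → a ∈ I

/-- A Noetherian ring of characteristic `p` is *`F`-rational* if every ideal of the principal class,
i.e. every ideal `I` that is generated by `n = height I` elements, is tightly closed. -/
def IsFRational (p : ℕ) (R : Type u) [CommRing R] : Prop :=
  ∀ (n : ℕ) (a : Fin n → R), (Ideal.span (Set.range a)).height = n →
    (Ideal.span (Set.range a)).IsTightlyClosed p

/-! ### The list of hypersurface singularities -/

/-- The labels of the types. -/
inductive CDVType : Type
  /-- `E N r` is the type `E_N^r F_4`. -/
  | E (N r : ℕ)
  /-- `DB N r b` is the type `D_N^r B_b`. -/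
  | DB (N r b : ℕ)
  /-- `DC N r c` is the type `D_N^r C_c`. -/
  | DC (N r c : ℕ)

/-- `IsDefiningPolynomial x y z w t f` says that `f`, an expression in the coordinates `x, y, z, w`,
is a polynomial from the list whose label is `t`. A few labels carry two (analytically equivalent)
polynomials. -/
inductive IsDefiningPolynomial {A : Type u} [CommRing A] (x y z w : A) : CDVType → A → Prop
  -- Types `E`
  | E_7_3 : IsDefiningPolynomial x y z w (.E 7 3)
      (z ^ 2 + x ^ 3 + x * y ^ 3 + x * y * z + w * y ^ 4)
  | E_7_2 : IsDefiningPolynomial x y z w (.E 7 2)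
      (z ^ 2 + x ^ 3 + x * y ^ 3 + y ^ 3 * z + w * y ^ 4)
  | E_7_1 : IsDefiningPolynomial x y z w (.E 7 1)
      (z ^ 2 + x ^ 3 + x * y ^ 3 + w * y ^ 4)
  | E_8_3 : IsDefiningPolynomial x y z w (.E 8 3)
      (z ^ 2 + x ^ 3 + y ^ 3 * z + w * y ^ 4)
  | E_8_2 : IsDefiningPolynomial x y z w (.E 8 2)
      (z ^ 2 + x ^ 3 + x * y ^ 2 * z + w * y ^ 4)
  | E_8_1 : IsDefiningPolynomial x y z w (.E 8 1)
      (z ^ 2 + x ^ 3 + x * y ^ 3 * z + w * y ^ 4)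
  | E_8_0 : IsDefiningPolynomial x y z w (.E 8 0)
      (z ^ 2 + x ^ 3 + w * y ^ 4)
  -- Types `D_4` and `D_5`
  | D_4_1_B_1 : IsDefiningPolynomial x y z w (.DB 4 1 1)
      (z ^ 2 + x * y * z + w * x ^ 2 + y ^ 3)
  | D_4_1_B_2 : IsDefiningPolynomial x y z w (.DB 4 1 2)
      (z ^ 2 + x * y ^ 2 + x * y * z + w * x ^ 2)
  | D_4_0_B_1 : IsDefiningPolynomial x y z w (.DB 4 0 1)
      (z ^ 2 + w * x ^ 2 + y ^ 3)
  | D_4_0_B_2 : IsDefiningPolynomial x y z w (.DB 4 0 2)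
      (z ^ 2 + x * y ^ 2 + w * x ^ 2)
  | D_5_1_C_3 : IsDefiningPolynomial x y z w (.DC 5 1 3)
      (z ^ 2 + x ^ 2 * y + y ^ 2 * z + x * y * z + w * y ^ 3)
  | D_5_0_C_3 : IsDefiningPolynomial x y z w (.DC 5 0 3)
      (z ^ 2 + x ^ 2 * y + y ^ 2 * z + w * y ^ 3)
  -- Types `D_6^1 B_2` and `D_6^1 B_3`, in the form without the monomial `x * y ^ 2 * z`;
  -- the form with this monomial is the case `n = 3`, `r = 1` of the families below.
  | D_6_1_B_2 : IsDefiningPolynomial x y z w (.DB 6 1 2)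
      (z ^ 2 + x * y ^ 3 + w * x ^ 2 + y ^ 5)
  | D_6_1_B_3 : IsDefiningPolynomial x y z w (.DB 6 1 3)
      (z ^ 2 + x * y ^ 3 + w * x ^ 2)
  -- Types `D_{2n}^r` with `n / 2 < r ≤ n - 1`
  | D_even_B_large (n r b : ℕ) (hn : 3 ≤ n) (hr : n < 2 * r) (hr' : r + 1 ≤ n)
      (hb : r ≤ b) (hb' : b + 1 ≤ n) : IsDefiningPolynomial x y z w (.DB (2 * n) r b)
      (z ^ 2 + x * y ^ n + x * y ^ (n - r) * z + w * x ^ 2 + y ^ (2 * b + 1))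
  | D_even_C_large (n r c : ℕ) (hn : 3 ≤ n) (hr : n < 2 * r) (hr' : r + 1 ≤ n)
      (hc : 2 * r ≤ c) (hc' : c + 2 ≤ 2 * n) : IsDefiningPolynomial x y z w (.DC (2 * n) r c)
      (z ^ 2 + x ^ 2 * y + x * y ^ n + x * y ^ (n - r) * z + w * y ^ c)
  -- Types `D_{2n}^r` with `1 ≤ r ≤ n / 2`
  | D_even_B_small (n r b : ℕ) (hn : 3 ≤ n) (hr : 1 ≤ r) (hr' : 2 * r ≤ n)
      (hb : (n + 1) / 2 ≤ b) (hb' : b + 1 ≤ n) : IsDefiningPolynomial x y z w (.DB (2 * n) r b)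
      (z ^ 2 + x * y ^ n + x * y ^ (n - r) * z + w * x ^ 2 + y ^ (2 * b + 1))
  | D_even_C_small (n r c : ℕ) (hn : 3 ≤ n) (hr : 1 ≤ r) (hr' : 2 * r ≤ n)
      (hc : n ≤ c) (hc' : c + 2 ≤ 2 * n) : IsDefiningPolynomial x y z w (.DC (2 * n) r c)
      (z ^ 2 + x ^ 2 * y + x * y ^ n + x * y ^ (n - r) * z + w * y ^ c)
  -- Types `D_{2n}^r B_n` with `1 ≤ r ≤ n - 1`
  | D_even_B_top (n r : ℕ) (hn : 3 ≤ n) (hr : 1 ≤ r) (hr' : r + 1 ≤ n) :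
      IsDefiningPolynomial x y z w (.DB (2 * n) r n)
      (z ^ 2 + x * y ^ n + x * y ^ (n - r) * z + w * x ^ 2)
  -- Types `D_{2n}^0`
  | D_even_zero_B (n b : ℕ) (hn : 3 ≤ n) (hn' : Even n) (hb : n ≤ 2 * b) (hb' : b + 1 ≤ n) :
      IsDefiningPolynomial x y z w (.DB (2 * n) 0 b)
      (z ^ 2 + x * y ^ n + w * x ^ 2 + y ^ (2 * b + 1))
  | D_even_zero_B_top (n : ℕ) (hn : 3 ≤ n) (hn' : Even n) :
      IsDefiningPolynomial x y z w (.DB (2 * n) 0 n)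
      (z ^ 2 + x * y ^ n + w * x ^ 2)
  | D_even_zero_C (n c : ℕ) (hn : 3 ≤ n) (hc : n ≤ c) (hc' : c + 2 ≤ 2 * n) :
      IsDefiningPolynomial x y z w (.DC (2 * n) 0 c)
      (z ^ 2 + x ^ 2 * y + x * y ^ n + w * y ^ c)
  | D_even_zero_C_bot (n : ℕ) (hn : 3 ≤ n) : IsDefiningPolynomial x y z w (.DC (2 * n) 0 n)
      (z ^ 2 + x ^ 2 * y + w * y ^ n)
  -- Types `D_{2n+1}^r`
  | D_odd_B (n : ℕ) (hn : 3 ≤ n) :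
      IsDefiningPolynomial x y z w (.DB (2 * n + 1) (n - 1) (n - 1))
      (z ^ 2 + x * y * z + w * x ^ 2 + y ^ (2 * n - 1))
  | D_odd_C_large (n r c : ℕ) (hn : 3 ≤ n) (hr : n < 2 * r) (hr' : r + 1 ≤ n)
      (hc : 2 * r + 1 ≤ c) (hc' : c + 1 ≤ 2 * n) :
      IsDefiningPolynomial x y z w (.DC (2 * n + 1) r c)
      (z ^ 2 + x ^ 2 * y + y ^ n * z + x * y ^ (n - r) * z + w * y ^ c)
  | D_odd_C_small (n r c : ℕ) (hn : 3 ≤ n) (hr : 1 ≤ r) (hr' : 2 * r ≤ n)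
      (hc : n + 1 ≤ c) (hc' : c + 1 ≤ 2 * n) :
      IsDefiningPolynomial x y z w (.DC (2 * n + 1) r c)
      (z ^ 2 + x ^ 2 * y + y ^ n * z + x * y ^ (n - r) * z + w * y ^ c)
  | D_odd_zero_C (n c : ℕ) (hn : 3 ≤ n) (hc : n + 1 ≤ c) (hc' : c + 1 ≤ 2 * n) :
      IsDefiningPolynomial x y z w (.DC (2 * n + 1) 0 c)
      (z ^ 2 + x ^ 2 * y + y ^ n * z + w * y ^ c)

/-! Every polynomial of the list has the shape `f = z² + u·xyz + x²a + y²b`, with `u = 1` for the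
labels in (i) and `u = 0` otherwise (`normal_form`). In `R = S/(f)` the ideal `I = (x, y)` has
height 2 and does not contain `z`, and everything is read off from `z` and `I`.

If `u = 0`, then `z² ∈ (x², y²)` although `z ∉ I`; a pure Frobenius would contract `z` into `I`, so
`R` is not `F`-pure (`not_isFPure_of_sq_mem`). If `u = 1`, then `xyzw` is the only monomial of `fw`
with all exponents odd, so the trace of Frobenius sends `fw` to 1, and `g ↦ Tr(fwg)` descends to a
splitting of Frobenius on `R` (`isFPure_quotient_of_frobeniusTrace`).

For every `u`, repeated squaring of the equation gives `z^q ∈ ((xy)^(q-1) z, x^q, y^q)` for `q =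
2^e`. Hence `x z^q ∈ I^[q]`, so `z` lies in the tight closure of the parameter ideal `I` but not in
`I` (`memTightClosure_span_pair`). -/

/-! ### Purity -/

namespace RingHom

variable {R : Type u} {S : Type v} [CommRing R] [CommRing S]

/-- A ring homomorphism with an `R`-linear retraction is pure. -/
theorem isPureHom_of_retraction (φ : R →+* S) (ρ : S →+ R)
    (hρ : ∀ a s, ρ (φ a * s) = a * ρ s) (h1 : ρ 1 = 1) : φ.IsPureHom := by
  let : Algebra R S := φ.toAlgebra
  intro M _ _
  let ρ' : S →ₗ[R] R :=
    { ρ with map_smul' := fun a s => (congrArg ρ (Algebra.smul_def a s)).trans (hρ a s) }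
  refine Function.LeftInverse.injective
    (g := (TensorProduct.lid R M).toLinearMap ∘ₗ ρ'.rTensor M) fun m => ?_
  have h1' : ρ' 1 = 1 := h1
  simp [h1']

/-- Ideals are contracted along a pure ring homomorphism. -/
theorem IsPureHom.mem_of_mem_map {R S : Type u} [CommRing R] [CommRing S] {φ : R →+* S}
    (hφ : φ.IsPureHom) {I : Ideal R} {a : R}
    (ha : φ a ∈ I.map φ) : a ∈ I := by
  let : Algebra R S := φ.toAlgebra
  -- The extension of `I` to `S` dies in `S ⊗ R/I`; so `1 ⊗ a`, which equals `φ a ⊗ 1`, vanishes,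
  -- and purity for `M = R/I` gives `a ∈ I`.
  have key : ∀ s ∈ I.map φ, s ⊗ₜ[R] (1 : R ⧸ I) = 0 := by
    intro s hs
    refine Submodule.span_induction (p := fun s _ => s ⊗ₜ[R] (1 : R ⧸ I) = 0) ?_ ?_ ?_ ?_ hs
    · rintro _ ⟨i, hi, rfl⟩
      have : φ i = i • (1 : S) := by
        rw [Algebra.smul_def, mul_one]
        rfl
      rw [this, TensorProduct.smul_tmul, Algebra.smul_def, mul_one,
        Ideal.Quotient.algebraMap_eq, Ideal.Quotient.eq_zero_iff_mem.mpr hi,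
        TensorProduct.tmul_zero]
    · exact TensorProduct.zero_tmul _ _
    · intro s t _ _ hs ht
      rw [TensorProduct.add_tmul, hs, ht, add_zero]
    · intro c s _ hs
      have := congrArg ((LinearMap.mulLeft R c).rTensor (R ⧸ I)) hs
      simpa using this
  have h0 : (1 : S) ⊗ₜ[R] (Ideal.Quotient.mk I a) = (1 : S) ⊗ₜ[R] (0 : R ⧸ I) := by
    have h2 : Ideal.Quotient.mk I a = a • (1 : R ⧸ I) := by
      rw [Algebra.smul_def, mul_one]
      rfl
    have h3 : a • (1 : S) = φ a := by
      rw [Algebra.smul_def, mul_one]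
      rfl
    rw [h2, ← TensorProduct.smul_tmul, h3, key _ ha, TensorProduct.tmul_zero]
  exact Ideal.Quotient.eq_zero_iff_mem.mp (hφ (R ⧸ I) h0)

end RingHom

/-! ### The heights of primes of a polynomial ring that contain variables -/

namespace MvPolynomial

section Height

variable {σ : Type v} {k : Type u} [Field k]

open Classical in
/-- The endomorphism of a polynomial ring that kills the variables in `s`. -/
noncomputable def killVars (s : Finset σ) : MvPolynomial σ k →ₐ[k] MvPolynomial σ k :=
  aeval fun i => if i ∈ s then 0 else X i

theorem killVars_X_of_mem {s : Finset σ} {i : σ} (h : i ∈ s) :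
    killVars (k := k) s (X i) = 0 := by
  simp [killVars, h]

theorem killVars_X_of_notMem {s : Finset σ} {i : σ} (h : i ∉ s) :
    killVars (k := k) s (X i) = X i := by
  simp [killVars, h]

instance isPrime_ker_killVars (s : Finset σ) :
    (RingHom.ker (killVars (k := k) s)).IsPrime :=
  RingHom.ker_isPrime _

theorem ker_killVars_le {s : Finset σ} {I : Ideal (MvPolynomial σ k)} (h : ∀ i ∈ s, X i ∈ I) :
    RingHom.ker (killVars (k := k) s) ≤ I := by
  have key : (Ideal.Quotient.mkₐ k I).comp (killVars s) = Ideal.Quotient.mkₐ k I := by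
    refine algHom_ext fun i => ?_
    by_cases hi : i ∈ s
    · simpa [killVars_X_of_mem hi, eq_comm] using Ideal.Quotient.eq_zero_iff_mem.mpr (h i hi)
    · simp [killVars_X_of_notMem hi]
  intro g hg
  have := DFunLike.congr_fun key g
  rw [AlgHom.comp_apply, RingHom.mem_ker.mp hg, map_zero] at this
  exact Ideal.Quotient.eq_zero_iff_mem.mp this.symm

/-- Killing one more variable enlarges the prime kernel strictly, and each strict inclusion of
primes raises the height by at least one. -/
theorem card_le_height_ker_killVars (s : Finset σ) :
    (s.card : ℕ∞) ≤ (RingHom.ker (killVars (k := k) s)).height := by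
  classical
  induction s using Finset.induction_on with
  | empty => simp
  | insert i s hi ih =>
    rw [Finset.card_insert_of_notMem hi, Nat.cast_add, Nat.cast_one]
    refine (add_le_add_left ih 1).trans (Ideal.height_add_one_le_of_lt_of_isPrime ?_)
    refine lt_of_le_of_ne (ker_killVars_le fun j hj => ?_) fun h => ?_
    · exact killVars_X_of_mem (Finset.mem_insert_of_mem hj)
    · have : (X i : MvPolynomial σ k) ∈ RingHom.ker (killVars (k := k) s) :=
        h ▸ killVars_X_of_mem (Finset.mem_insert_self i s)
      rw [RingHom.mem_ker, killVars_X_of_notMem hi] at this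
      exact X_ne_zero i this

theorem card_le_height {s : Finset σ} {I : Ideal (MvPolynomial σ k)} (h : ∀ i ∈ s, X i ∈ I) :
    (s.card : ℕ∞) ≤ I.height :=
  (card_le_height_ker_killVars s).trans (Ideal.height_mono (ker_killVars_le h))

end Height

/-! ### The trace of Frobenius -/

section Trace

variable {σ : Type v} {k : Type u} [Field k] [CharP k 2] [PerfectRing k 2]

open Classical in
/-- The value of `frobeniusTrace` at the monomial with exponent `m` and coefficient `c`. -/
noncomputable def frobeniusTraceTerm (m : σ →₀ ℕ) : k →+ MvPolynomial σ k :=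
  if ∀ i, Odd (m i) then
    (monomial (m.mapRange (· / 2) rfl)).toAddMonoidHom.comp
      ((frobeniusEquiv k 2).symm : k →+* k).toAddMonoidHom
  else 0

/-- The generator of `Hom (F_* S, S)` for a polynomial ring `S` over a perfect field of
characteristic `2`: the square root of the coefficient of the product of all variables with respect
to the basis of squarefree monomials. -/
noncomputable def frobeniusTrace : MvPolynomial σ k →+ MvPolynomial σ k where
  toFun g := Finsupp.sum (AddMonoidAlgebra.coeff g) fun m c => frobeniusTraceTerm m c
  map_zero' := by simp
  map_add' g h := by
    rw [AddMonoidAlgebra.coeff_add]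
    exact Finsupp.sum_add_index' (fun m => map_zero _) (fun m => map_add _)

theorem frobeniusTrace_monomial (m : σ →₀ ℕ) (c : k) :
    frobeniusTrace (monomial m c) = frobeniusTraceTerm m c :=
  Finsupp.sum_single_index (map_zero _)

/-- Both sides are additive in `g` and in `h` because squaring is additive in characteristic 2. On
monomials, adding `2m` to an exponent preserves parities and adds exactly `m` to its half. -/
theorem frobeniusTrace_sq_mul (g h : MvPolynomial σ k) :
    frobeniusTrace (g ^ 2 * h) = g * frobeniusTrace h := by
  induction g using MvPolynomial.induction_on' with
  | add g₁ g₂ h₁ h₂ => rw [CharTwo.add_sq, add_mul, map_add, h₁, h₂, add_mul]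
  | monomial m c =>
    induction h using MvPolynomial.induction_on' with
    | add g₁ g₂ h₁ h₂ => rw [mul_add, map_add, h₁, h₂, map_add, mul_add]
    | monomial n d =>
      rw [monomial_pow, monomial_mul, frobeniusTrace_monomial, frobeniusTrace_monomial]
      have hodd : (∀ i, Odd ((2 • m + n) i)) ↔ ∀ i, Odd (n i) := by
        refine forall_congr' fun i => ?_
        simp [Nat.odd_add']
      by_cases hn : ∀ i, Odd (n i)
      · have hexp : (2 • m + n).mapRange (· / 2) rfl = m + n.mapRange (· / 2) rfl := by
          ext i
          simp only [Finsupp.mapRange_apply, Finsupp.add_apply, Finsupp.smul_apply, smul_eq_mul]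
          omega
        have hsqrt : (frobeniusEquiv k 2).symm (c ^ 2 * d) = c * (frobeniusEquiv k 2).symm d := by
          rw [map_mul, ← frobenius_def, frobeniusEquiv_symm_apply_frobenius]
        rw [frobeniusTraceTerm, if_pos (hodd.mpr hn), frobeniusTraceTerm, if_pos hn]
        simp [hexp, hsqrt, monomial_mul]
      · rw [frobeniusTraceTerm, if_neg (mt hodd.mp hn), frobeniusTraceTerm, if_neg hn]
        simp

end Trace

section Coordinates

variable {k : Type u} [Field k] [CharP k 2] [PerfectRing k 2]

theorem frobeniusTrace_X_pow_eq_zero {a b c d : ℕ} (h : Even a ∨ Even b ∨ Even c ∨ Even d) :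
    frobeniusTrace (X 0 ^ a * X 1 ^ b * X 2 ^ c * X 3 ^ d : MvPolynomial (Fin 4) k) = 0 := by
  simp only [X_pow_eq_monomial, monomial_mul, frobeniusTrace_monomial]
  rw [frobeniusTraceTerm, if_neg]
  · simp
  · intro h'
    have h0 := h' 0
    have h1 := h' 1
    have h2 := h' 2
    have h3 := h' 3
    simp at h0 h1 h2 h3
    grind

theorem frobeniusTrace_X_mul :
    frobeniusTrace (X 0 * X 1 * X 2 * X 3 : MvPolynomial (Fin 4) k) = 1 := by
  simp only [X, monomial_mul, frobeniusTrace_monomial]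
  rw [frobeniusTraceTerm, if_pos]
  · have : (Finsupp.single (0 : Fin 4) 1 + Finsupp.single 1 1 + Finsupp.single 2 1 +
        Finsupp.single 3 1 : Fin 4 →₀ ℕ).mapRange (· / 2) rfl = 0 := by
      ext i
      fin_cases i <;> simp
    simp [this]
  · intro i
    fin_cases i <;> simp

end Coordinates
end MvPolynomial

/-! ### Labels and the normal form of the equations -/

/-- The labels of the `F`-pure types. -/
def CDVType.IsPureLabel (t : CDVType) : Prop :=
  t = .E 7 3 ∨ t = .DB 4 1 1 ∨ t = .DB 4 1 2 ∨ t = .DC 5 1 3 ∨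
    ∃ n : ℕ, 3 ≤ n ∧
      (t = .DB (2 * n) (n - 1) (n - 1) ∨ t = .DB (2 * n) (n - 1) n ∨
        t = .DC (2 * n) (n - 1) (2 * n - 2) ∨
        t = .DB (2 * n + 1) (n - 1) (n - 1) ∨ t = .DC (2 * n + 1) (n - 1) (2 * n - 1))

namespace CDVType

theorem isPureLabel_E_iff {N r : ℕ} : (E N r).IsPureLabel ↔ N = 7 ∧ r = 3 := by
  simp [IsPureLabel]

/-- Solving `r = n - 1` for `n` removes the quantifier and the truncated subtraction, leaving linear
arithmetic. -/
theorem isPureLabel_DB_iff {N r b : ℕ} : (DB N r b).IsPureLabel ↔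
    N = 4 ∧ r = 1 ∧ (b = 1 ∨ b = 2) ∨
      2 ≤ r ∧ (N = 2 * r + 2 ∧ (b = r ∨ b = r + 1) ∨ N = 2 * r + 3 ∧ b = r) := by
  simp only [IsPureLabel, reduceCtorEq, false_or, or_false, DB.injEq]
  constructor
  · rintro (h | h | ⟨n, hn, h | h | h⟩) <;> omega
  · rintro (⟨h1, h2, h | h⟩ | ⟨hr, h⟩)
    · omega
    · omega
    · exact Or.inr (Or.inr ⟨r + 1, by omega⟩)

theorem isPureLabel_DC_iff {N r c : ℕ} : (DC N r c).IsPureLabel ↔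
    N = 5 ∧ r = 1 ∧ c = 3 ∨
      2 ≤ r ∧ (N = 2 * r + 2 ∧ c = 2 * r ∨ N = 2 * r + 3 ∧ c = 2 * r + 1) := by
  simp only [IsPureLabel, reduceCtorEq, false_or, DC.injEq]
  constructor
  · rintro (h | ⟨n, hn, h | h⟩) <;> omega
  · rintro (h | ⟨hr, h⟩)
    · omega
    · exact Or.inr ⟨r + 1, by omega⟩

end CDVType

/-- Every polynomial of the list is `z ^ 2 + x ^ 2 * a + y ^ 2 * b`, with an additional term
`x * y * z` exactly for the `F`-pure labels. An additive map that kills all monomials with an even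
exponent sees nothing but this term of `f * w`. -/
theorem IsDefiningPolynomial.normal_form {A : Type u} [CommRing A] {x y z w : A} {t : CDVType}
    {f : A} (hf : IsDefiningPolynomial x y z w t f) (T : A →+ A)
    (hT : ∀ a b c d : ℕ, (Even a ∨ Even b ∨ Even c ∨ Even d) →
      T (x ^ a * y ^ b * z ^ c * w ^ d) = 0) :
    (¬ t.IsPureLabel ∧ ∃ a b, f = z ^ 2 + x ^ 2 * a + y ^ 2 * b) ∨
    (t.IsPureLabel ∧ T (f * w) = T (x * y * z * w) ∧
      ∃ a b, f = z ^ 2 + x * y * z + x ^ 2 * a + y ^ 2 * b) := by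
  have hy : ∀ m : ℕ, 2 ≤ m → y ^ m = y ^ 2 * y ^ (m - 2) := fun m hm => by
    rw [← pow_add, Nat.add_sub_cancel' hm]
  have hw : ∀ f g : A, f * w = x * y * z * w + g → T g = 0 → T (f * w) = T (x * y * z * w) :=
    fun f g h hg => by rw [h, map_add, hg, add_zero]
  cases hf with
  | E_7_3 =>
    refine Or.inr ⟨by rw [CDVType.isPureLabel_E_iff]; omega, ?_, x, x * y + w * y ^ 2, by ring⟩
    -- These are the monomials of `f * w` other than `xyzw`; each has an even exponent, where a
    -- missing variable counts as exponent 0.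
    refine hw _ (x ^ 0 * y ^ 0 * z ^ 2 * w ^ 1 +
      x ^ 3 * y ^ 0 * z ^ 0 * w ^ 1 +
      x ^ 1 * y ^ 3 * z ^ 0 * w ^ 1 +
      x ^ 0 * y ^ 4 * z ^ 0 * w ^ 2) (by ring) ?_
    simp only [map_add]
    rw [hT 0 0 2 1 (by simp), hT 3 0 0 1 (by simp), hT 1 3 0 1 (by simp), hT 0 4 0 2 (by simp)]
    simp
  | E_7_2 =>
    exact Or.inl ⟨by rw [CDVType.isPureLabel_E_iff]; omega, x, x * y + y * z + w * y ^ 2, by ring⟩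
  | E_7_1 =>
    exact Or.inl ⟨by rw [CDVType.isPureLabel_E_iff]; omega, x, x * y + w * y ^ 2, by ring⟩
  | E_8_3 =>
    exact Or.inl ⟨by rw [CDVType.isPureLabel_E_iff]; omega, x, y * z + w * y ^ 2, by ring⟩
  | E_8_2 =>
    exact Or.inl ⟨by rw [CDVType.isPureLabel_E_iff]; omega, x, x * z + w * y ^ 2, by ring⟩
  | E_8_1 =>
    exact Or.inl ⟨by rw [CDVType.isPureLabel_E_iff]; omega, x, x * y * z + w * y ^ 2, by ring⟩
  | E_8_0 =>
    exact Or.inl ⟨by rw [CDVType.isPureLabel_E_iff]; omega, x, w * y ^ 2, by ring⟩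
  | D_4_1_B_1 =>
    refine Or.inr ⟨by rw [CDVType.isPureLabel_DB_iff]; omega, ?_, w, y, by ring⟩
    refine hw _ (x ^ 0 * y ^ 0 * z ^ 2 * w ^ 1 +
      x ^ 2 * y ^ 0 * z ^ 0 * w ^ 2 +
      x ^ 0 * y ^ 3 * z ^ 0 * w ^ 1) (by ring) ?_
    simp only [map_add]
    rw [hT 0 0 2 1 (by simp), hT 2 0 0 2 (by simp), hT 0 3 0 1 (by simp)]
    simp
  | D_4_1_B_2 =>
    refine Or.inr ⟨by rw [CDVType.isPureLabel_DB_iff]; omega, ?_, w, x, by ring⟩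
    refine hw _ (x ^ 0 * y ^ 0 * z ^ 2 * w ^ 1 +
      x ^ 2 * y ^ 0 * z ^ 0 * w ^ 2 +
      x ^ 1 * y ^ 2 * z ^ 0 * w ^ 1) (by ring) ?_
    simp only [map_add]
    rw [hT 0 0 2 1 (by simp), hT 2 0 0 2 (by simp), hT 1 2 0 1 (by simp)]
    simp
  | D_4_0_B_1 =>
    exact Or.inl ⟨by rw [CDVType.isPureLabel_DB_iff]; omega, w, y, by ring⟩
  | D_4_0_B_2 =>
    exact Or.inl ⟨by rw [CDVType.isPureLabel_DB_iff]; omega, w, x, by ring⟩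
  | D_5_1_C_3 =>
    refine Or.inr ⟨by rw [CDVType.isPureLabel_DC_iff]; omega, ?_, y, z + w * y, by ring⟩
    refine hw _ (x ^ 0 * y ^ 0 * z ^ 2 * w ^ 1 +
      x ^ 2 * y ^ 1 * z ^ 0 * w ^ 1 +
      x ^ 0 * y ^ 2 * z ^ 1 * w ^ 1 +
      x ^ 0 * y ^ 3 * z ^ 0 * w ^ 2) (by ring) ?_
    simp only [map_add]
    rw [hT 0 0 2 1 (by simp), hT 2 1 0 1 (by simp), hT 0 2 1 1 (by simp), hT 0 3 0 2 (by simp)]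
    simp
  | D_5_0_C_3 =>
    exact Or.inl ⟨by rw [CDVType.isPureLabel_DC_iff]; omega, y, z + w * y, by ring⟩
  | D_6_1_B_2 =>
    exact Or.inl ⟨by rw [CDVType.isPureLabel_DB_iff]; omega, w, x * y + y ^ 3, by ring⟩
  | D_6_1_B_3 =>
    exact Or.inl ⟨by rw [CDVType.isPureLabel_DB_iff]; omega, w, x * y, by ring⟩
  | D_even_B_large n r b hn hr hr' hb hb' =>
    -- For `n = r + 1` the monomial `x y^(n-r) z` is `xyz`; otherwise it is divisible by `y²` and is
    -- absorbed into `b`.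
    obtain h | h : n = r + 1 ∨ r + 2 ≤ n := by omega
    · obtain rfl := h; rw [Nat.add_sub_cancel_left, pow_one]
      refine Or.inr ⟨by rw [CDVType.isPureLabel_DB_iff]; omega,
          ?_, w, x * y ^ (r + 1 - 2) + y ^ (2 * b + 1 - 2),
          by rw [hy (r + 1) (by omega), hy (2 * b + 1) (by omega)]; ring⟩
      refine hw _ (x ^ 0 * y ^ 0 * z ^ 2 * w ^ 1 +
      x ^ 1 * y ^ (r + 1) * z ^ 0 * w ^ 1 +
      x ^ 2 * y ^ 0 * z ^ 0 * w ^ 2 +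
      x ^ 0 * y ^ (2 * b + 1) * z ^ 0 * w ^ 1) (by ring) ?_
      simp only [map_add]
      rw [hT 0 0 2 1 (by simp), hT 1 (r + 1) 0 1 (by simp), hT 2 0 0 2 (by simp),
        hT 0 (2 * b + 1) 0 1 (by simp)]
      simp
    · exact Or.inl ⟨by rw [CDVType.isPureLabel_DB_iff]; omega,
          w, x * y ^ (n - 2) + x * y ^ (n - r - 2) * z + y ^ (2 * b + 1 - 2),
          by rw [hy n (by omega), hy (n - r) (by omega), hy (2 * b + 1) (by omega)]; ring⟩
  | D_even_C_large n r c hn hr hr' hc hc' =>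
    obtain h | h : n = r + 1 ∨ r + 2 ≤ n := by omega
    · obtain rfl := h; rw [Nat.add_sub_cancel_left, pow_one]
      refine Or.inr ⟨by rw [CDVType.isPureLabel_DC_iff]; omega,
          ?_, y, x * y ^ (r + 1 - 2) + w * y ^ (c - 2),
          by rw [hy (r + 1) (by omega), hy c (by omega)]; ring⟩
      refine hw _ (x ^ 0 * y ^ 0 * z ^ 2 * w ^ 1 +
      x ^ 2 * y ^ 1 * z ^ 0 * w ^ 1 +
      x ^ 1 * y ^ (r + 1) * z ^ 0 * w ^ 1 +
      x ^ 0 * y ^ c * z ^ 0 * w ^ 2) (by ring) ?_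
      simp only [map_add]
      rw [hT 0 0 2 1 (by simp), hT 2 1 0 1 (by simp), hT 1 (r + 1) 0 1 (by simp),
        hT 0 c 0 2 (by simp)]
      simp
    · exact Or.inl ⟨by rw [CDVType.isPureLabel_DC_iff]; omega,
          y, x * y ^ (n - 2) + x * y ^ (n - r - 2) * z + w * y ^ (c - 2),
          by rw [hy n (by omega), hy (n - r) (by omega), hy c (by omega)]; ring⟩
  | D_even_B_small n r b hn hr hr' hb hb' =>
    -- Here `2r ≤ n` and `n ≥ 3` force `n - r ≥ 2`, so `xyz` cannot occur.
    exact Or.inl ⟨by rw [CDVType.isPureLabel_DB_iff]; omega,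
        w, x * y ^ (n - 2) + x * y ^ (n - r - 2) * z + y ^ (2 * b + 1 - 2),
        by rw [hy n (by omega), hy (n - r) (by omega), hy (2 * b + 1) (by omega)]; ring⟩
  | D_even_C_small n r c hn hr hr' hc hc' =>
    exact Or.inl ⟨by rw [CDVType.isPureLabel_DC_iff]; omega,
        y, x * y ^ (n - 2) + x * y ^ (n - r - 2) * z + w * y ^ (c - 2),
        by rw [hy n (by omega), hy (n - r) (by omega), hy c (by omega)]; ring⟩
  | D_even_B_top n r hn hr hr' =>
    obtain h | h : n = r + 1 ∨ r + 2 ≤ n := by omega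
    · obtain rfl := h; rw [Nat.add_sub_cancel_left, pow_one]
      refine Or.inr ⟨by rw [CDVType.isPureLabel_DB_iff]; omega,
          ?_, w, x * y ^ (r + 1 - 2),
          by rw [hy (r + 1) (by omega)]; ring⟩
      refine hw _ (x ^ 0 * y ^ 0 * z ^ 2 * w ^ 1 +
      x ^ 1 * y ^ (r + 1) * z ^ 0 * w ^ 1 +
      x ^ 2 * y ^ 0 * z ^ 0 * w ^ 2) (by ring) ?_
      simp only [map_add]
      rw [hT 0 0 2 1 (by simp), hT 1 (r + 1) 0 1 (by simp), hT 2 0 0 2 (by simp)]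
      simp
    · exact Or.inl ⟨by rw [CDVType.isPureLabel_DB_iff]; omega,
          w, x * y ^ (n - 2) + x * y ^ (n - r - 2) * z,
          by rw [hy n (by omega), hy (n - r) (by omega)]; ring⟩
  | D_even_zero_B n b hn hn' hb hb' =>
    exact Or.inl ⟨by rw [CDVType.isPureLabel_DB_iff]; omega,
        w, x * y ^ (n - 2) + y ^ (2 * b + 1 - 2),
        by rw [hy n (by omega), hy (2 * b + 1) (by omega)]; ring⟩
  | D_even_zero_B_top n hn hn' =>
    exact Or.inl ⟨by rw [CDVType.isPureLabel_DB_iff]; omega,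
        w, x * y ^ (n - 2),
        by rw [hy n (by omega)]; ring⟩
  | D_even_zero_C n c hn hc hc' =>
    exact Or.inl ⟨by rw [CDVType.isPureLabel_DC_iff]; omega,
        y, x * y ^ (n - 2) + w * y ^ (c - 2),
        by rw [hy n (by omega), hy c (by omega)]; ring⟩
  | D_even_zero_C_bot n hn =>
    exact Or.inl ⟨by rw [CDVType.isPureLabel_DC_iff]; omega,
        y, w * y ^ (n - 2),
        by rw [hy n (by omega)]; ring⟩
  | D_odd_B n hn =>
    refine Or.inr ⟨by rw [CDVType.isPureLabel_DB_iff]; omega,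
        ?_, w, y ^ (2 * n - 1 - 2),
        by rw [hy (2 * n - 1) (by omega)]; ring⟩
    refine hw _ (x ^ 0 * y ^ 0 * z ^ 2 * w ^ 1 +
      x ^ 2 * y ^ 0 * z ^ 0 * w ^ 2 +
      x ^ 0 * y ^ (2 * n - 1) * z ^ 0 * w ^ 1) (by ring) ?_
    simp only [map_add]
    rw [hT 0 0 2 1 (by simp), hT 2 0 0 2 (by simp), hT 0 (2 * n - 1) 0 1 (by simp)]
    simp
  | D_odd_C_large n r c hn hr hr' hc hc' =>
    obtain h | h : n = r + 1 ∨ r + 2 ≤ n := by omega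
    · obtain rfl := h; rw [Nat.add_sub_cancel_left, pow_one]
      refine Or.inr ⟨by rw [CDVType.isPureLabel_DC_iff]; omega,
          ?_, y, y ^ (r + 1 - 2) * z + w * y ^ (c - 2),
          by rw [hy (r + 1) (by omega), hy c (by omega)]; ring⟩
      refine hw _ (x ^ 0 * y ^ 0 * z ^ 2 * w ^ 1 +
      x ^ 2 * y ^ 1 * z ^ 0 * w ^ 1 +
      x ^ 0 * y ^ (r + 1) * z ^ 1 * w ^ 1 +
      x ^ 0 * y ^ c * z ^ 0 * w ^ 2) (by ring) ?_
      simp only [map_add]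
      rw [hT 0 0 2 1 (by simp), hT 2 1 0 1 (by simp), hT 0 (r + 1) 1 1 (by simp),
        hT 0 c 0 2 (by simp)]
      simp
    · exact Or.inl ⟨by rw [CDVType.isPureLabel_DC_iff]; omega,
          y, y ^ (n - 2) * z + x * y ^ (n - r - 2) * z + w * y ^ (c - 2),
          by rw [hy n (by omega), hy (n - r) (by omega), hy c (by omega)]; ring⟩
  | D_odd_C_small n r c hn hr hr' hc hc' =>
    exact Or.inl ⟨by rw [CDVType.isPureLabel_DC_iff]; omega,
        y, y ^ (n - 2) * z + x * y ^ (n - r - 2) * z + w * y ^ (c - 2),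
        by rw [hy n (by omega), hy (n - r) (by omega), hy c (by omega)]; ring⟩
  | D_odd_zero_C n c hn hc hc' =>
    exact Or.inl ⟨by rw [CDVType.isPureLabel_DC_iff]; omega,
        y, y ^ (n - 2) * z + w * y ^ (c - 2),
        by rw [hy n (by omega), hy c (by omega)]; ring⟩

/-! ### Obstructions to `F`-purity and `F`-rationality -/

section CharTwo

variable {R : Type u} [CommRing R]

theorem not_isFPure_of_sq_mem {x y z a b : R} (h : z ^ 2 + x ^ 2 * a + y ^ 2 * b = 0)
    (hz : z ∉ Ideal.span {x, y}) : ¬ IsFPure 2 R := by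
  rintro ⟨_, hpure⟩
  refine hz (hpure.mem_of_mem_map ?_)
  have hx : x ^ 2 ∈ (Ideal.span {x, y}).map (frobenius R 2) :=
    Ideal.mem_map_of_mem _ (Ideal.subset_span (Set.mem_insert _ _))
  have hy : y ^ 2 ∈ (Ideal.span {x, y}).map (frobenius R 2) :=
    Ideal.mem_map_of_mem _ (Ideal.subset_span (Set.mem_insert_of_mem _ rfl))
  have : frobenius R 2 z = -(a * x ^ 2 + b * y ^ 2) := by
    rw [frobenius_def]
    linear_combination h
  rw [this]
  exact neg_mem (add_mem (Ideal.mul_mem_left _ _ hx) (Ideal.mul_mem_left _ _ hy))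

/-- Induction on `e`: square the relation termwise and use `h` to replace the `z²` that appears
beside `(xy)^(2q)`. Writing `2^e = q + 1` avoids subtraction in the exponents. -/
theorem exists_pow_two_pow_eq [CharP R 2] {x y z u a b : R}
    (h : z ^ 2 + u * (x * y * z) + x ^ 2 * a + y ^ 2 * b = 0) (e : ℕ) :
    ∃ q : ℕ, 2 ^ e = q + 1 ∧ ∃ v s t : R,
      z ^ (q + 1) = v * (x ^ q * y ^ q * z) + x ^ (q + 1) * s + y ^ (q + 1) * t := by
  induction e with
  | zero => exact ⟨0, rfl, 1, 0, 0, by ring⟩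
  | succ e ih =>
    obtain ⟨q, hq, v, s, t, hv⟩ := ih
    refine ⟨2 * q + 1, by rw [pow_succ, hq]; ring, -(v ^ 2 * u),
      s ^ 2 - v ^ 2 * y ^ (2 * q) * a,
      t ^ 2 - v ^ 2 * x ^ (2 * q) * b, ?_⟩
    have hsq := congrArg (· ^ 2) hv
    simp only [CharTwo.add_sq] at hsq
    linear_combination hsq + v ^ 2 * x ^ (2 * q) * y ^ (2 * q) * h

/-- The multiplier `c = x` works for all `e`: it turns `x^q y^q z` into a multiple of `x^(q+1)`. A
nonzerodivisor lies in no minimal prime. -/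
theorem memTightClosure_span_pair [CharP R 2] {x y z u a b : R}
    (h : z ^ 2 + u * (x * y * z) + x ^ 2 * a + y ^ 2 * b = 0) (hx : x ∈ nonZeroDivisors R) :
    (Ideal.span {x, y}).MemTightClosure 2 z := by
  refine ⟨x, fun P hP hxP => notMem_nonZeroDivisors_of_mem_mem_minimalPrimes hxP hP hx, 0,
    fun e _ => ?_⟩
  obtain ⟨q, hq, v, s, t, hv⟩ := exists_pow_two_pow_eq h e
  rw [hq, hv]
  have hx : x ^ (q + 1) ∈ (Ideal.span {x, y}).frobeniusPower (q + 1) :=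
    Ideal.subset_span ⟨x, Ideal.subset_span (Set.mem_insert _ _), rfl⟩
  have hy : y ^ (q + 1) ∈ (Ideal.span {x, y}).frobeniusPower (q + 1) :=
    Ideal.subset_span ⟨y, Ideal.subset_span (Set.mem_insert_of_mem _ rfl), rfl⟩
  have : x * (v * (x ^ q * y ^ q * z) + x ^ (q + 1) * s + y ^ (q + 1) * t) =
      (v * y ^ q * z + x * s) * x ^ (q + 1) + (x * t) * y ^ (q + 1) := by ring
  rw [this]
  exact add_mem (Ideal.mul_mem_left _ _ hx) (Ideal.mul_mem_left _ _ hy)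

theorem not_isFRational_of_span_pair [CharP R 2] {x y z u a b : R}
    (h : z ^ 2 + u * (x * y * z) + x ^ 2 * a + y ^ 2 * b = 0) (hx : x ∈ nonZeroDivisors R)
    (hz : z ∉ Ideal.span {x, y}) (hht : (Ideal.span {x, y}).height = 2) :
    ¬ IsFRational 2 R := by
  intro hR
  have hrange : Set.range ![x, y] = {x, y} := by simp [Set.pair_comm]
  have := hR 2 ![x, y]
  rw [hrange] at this
  exact hz (this hht z (memTightClosure_span_pair h hx))

end CharTwo

/-! ### The hypersurface ring and its ideal `(x, y)` -/

namespace MvPolynomial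

variable {k : Type u} [Field k]

/-- Fedder's criterion in the sufficient direction: if the trace of `f * g` is `1`, then `f`
defines an `F`-pure hypersurface. -/
theorem isFPure_quotient_of_frobeniusTrace {σ : Type v} [CharP k 2] [PerfectRing k 2]
    {f g : MvPolynomial σ k} [Nontrivial (MvPolynomial σ k ⧸ Ideal.span {f})]
    (h : frobeniusTrace (f * g) = 1) : IsFPure 2 (MvPolynomial σ k ⧸ Ideal.span {f}) := by
  refine ⟨charP_of_injective_algebraMap
    (algebraMap k (MvPolynomial σ k ⧸ Ideal.span {f})).injective 2, ?_⟩
  let ψ : MvPolynomial σ k →+ MvPolynomial σ k ⧸ Ideal.span {f} :=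
    (Ideal.Quotient.mk (Ideal.span {f})).toAddMonoidHom.comp
      (frobeniusTrace.comp (AddMonoidHom.mulLeft (f * g)))
  have hψ : ∀ b, ψ b = Ideal.Quotient.mk _ (frobeniusTrace (f * g * b)) := fun _ => rfl
  have hker : ∀ b ∈ (Ideal.span {f}).toAddSubgroup, ψ b = 0 := by
    intro b hb
    obtain ⟨c, rfl⟩ := Ideal.mem_span_singleton.mp hb
    -- The factor `f` in `ψ` completes a square on multiples of `f`, and the trace releases it as
    -- `f`, which is zero in the quotient.
    rw [hψ, show f * g * (f * c) = f ^ 2 * (g * c) by ring, frobeniusTrace_sq_mul, map_mul,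
      Ideal.Quotient.eq_zero_iff_mem.mpr (Ideal.mem_span_singleton_self f), zero_mul]
  let ρ : MvPolynomial σ k ⧸ Ideal.span {f} →+ MvPolynomial σ k ⧸ Ideal.span {f} :=
    QuotientAddGroup.lift _ ψ hker
  have hρ : ∀ b, ρ (Ideal.Quotient.mk _ b) = ψ b := fun _ => rfl
  refine RingHom.isPureHom_of_retraction _ ρ ?_ ?_
  · intro a s
    obtain ⟨a, rfl⟩ := Ideal.Quotient.mk_surjective a
    obtain ⟨s, rfl⟩ := Ideal.Quotient.mk_surjective s
    rw [frobenius_def, ← map_pow, ← map_mul, hρ, hρ, hψ, hψ, ← map_mul,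
      ← frobeniusTrace_sq_mul]
    congr 2
    ring
  · rw [← map_one (Ideal.Quotient.mk _), hρ, hψ, mul_one, h, map_one]

variable {f u a b : MvPolynomial (Fin 4) k}

theorem mk_X_two_notMem_span
    (hf : f = X 2 ^ 2 + u * (X 0 * X 1 * X 2) + X 0 ^ 2 * a + X 1 ^ 2 * b) :
    Ideal.Quotient.mk (Ideal.span {f}) (X 2) ∉ Ideal.span {Ideal.Quotient.mk (Ideal.span {f}) (X 0), Ideal.Quotient.mk (Ideal.span {f}) (X 1)} := by
  -- Modulo `x`, `y`, `w` the equation becomes `z² = 0`, so `z ↦ ε` factors through the quotient and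
  -- keeps `z` nonzero while killing `x` and `y`.
  let φ : MvPolynomial (Fin 4) k →ₐ[k] DualNumber k := aeval ![0, 0, DualNumber.eps, 0]
  have hφ : ∀ g ∈ Ideal.span {f}, φ g = 0 := by
    intro g hg
    obtain ⟨c, rfl⟩ := Ideal.mem_span_singleton.mp hg
    simp [hf, φ, pow_two]
  let φ' := Ideal.Quotient.lift (Ideal.span {f}) (φ : MvPolynomial (Fin 4) k →+* DualNumber k) hφ
  have hφ' : ∀ g, φ' (Ideal.Quotient.mk (Ideal.span {f}) g) = φ g := fun _ => rfl
  have hle : Ideal.span {Ideal.Quotient.mk (Ideal.span {f}) (X 0), Ideal.Quotient.mk (Ideal.span {f}) (X 1)} ≤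
      RingHom.ker φ' := by
    rw [Ideal.span_le]
    rintro _ (rfl | rfl) <;> simp [hφ', φ]
  intro hz
  have := hle hz
  have h1 := congrArg TrivSqZeroExt.snd (RingHom.mem_ker.mp this)
  simp [hφ', φ] at h1

/-- The variable `x` is prime and does not divide `f`, since `f(0, 0, 1, 0) = 1`; so in `gx = fh` it
divides `h`. -/
theorem mk_X_zero_mem_nonZeroDivisors
    (hf : f = X 2 ^ 2 + u * (X 0 * X 1 * X 2) + X 0 ^ 2 * a + X 1 ^ 2 * b) :
    Ideal.Quotient.mk (Ideal.span {f}) (X 0) ∈ nonZeroDivisors (MvPolynomial (Fin 4) k ⧸ Ideal.span {f}) := by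
  rw [mem_nonZeroDivisors_iff_right]
  intro g hg
  obtain ⟨g, rfl⟩ := Ideal.Quotient.mk_surjective g
  rw [← map_mul, Ideal.Quotient.eq_zero_iff_mem, Ideal.mem_span_singleton] at hg
  rw [Ideal.Quotient.eq_zero_iff_mem, Ideal.mem_span_singleton]
  obtain ⟨h, hh⟩ := hg
  have hfx : ¬ (X 0 : MvPolynomial (Fin 4) k) ∣ f := by
    rintro ⟨c, hc⟩
    have := congrArg (eval ![0, 0, 1, 0]) (hf.symm.trans hc)
    simp at this
  obtain ⟨c, rfl⟩ := (X_prime.dvd_or_dvd (Dvd.intro_left g hh)).resolve_left hfx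
  exact ⟨c, mul_right_cancel₀ (X_ne_zero 0) (by rw [hh]; ring)⟩

/-- The upper bound is Krull's height theorem. For the lower bound, a prime over `(x, y)` contains
`z`, because `z² ∈ (x, y)`; its preimage contains three variables, so has height at least 3, and
passing modulo `f` costs at most one. -/
theorem height_span_mk_X (hf : f = X 2 ^ 2 + u * (X 0 * X 1 * X 2) + X 0 ^ 2 * a + X 1 ^ 2 * b) :
    (Ideal.span {Ideal.Quotient.mk (Ideal.span {f}) (X 0), Ideal.Quotient.mk (Ideal.span {f}) (X 1)}).height = 2 := by
  apply le_antisymm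
  · have hne : Ideal.span {Ideal.Quotient.mk (Ideal.span {f}) (X 0), Ideal.Quotient.mk (Ideal.span {f}) (X 1)} ≠ ⊤ := fun h => mk_X_two_notMem_span hf (h ▸ Submodule.mem_top)
    calc (Ideal.span {Ideal.Quotient.mk (Ideal.span {f}) (X 0), Ideal.Quotient.mk (Ideal.span {f}) (X 1)}).height ≤ (Ideal.span {Ideal.Quotient.mk (Ideal.span {f}) (X 0), Ideal.Quotient.mk (Ideal.span {f}) (X 1)}).spanFinrank :=
          Ideal.height_le_spanFinrank _ hne
      _ ≤ ({Ideal.Quotient.mk (Ideal.span {f}) (X 0), Ideal.Quotient.mk (Ideal.span {f}) (X 1)} : Set _).encard := Submodule.spanFinrank_span_le_encard _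
      _ ≤ 2 := (Set.encard_insert_le _ _).trans (by rw [Set.encard_singleton]; norm_num)
  · rw [Ideal.height_eq_inf_minimalPrimes]
    refine le_iInf₂ fun P hP => ?_
    have hprime := hP.isPrime
    have hxP : Ideal.Quotient.mk (Ideal.span {f}) (X 0) ∈ P := hP.1.2 (Ideal.subset_span (Set.mem_insert _ _))
    have hyP : Ideal.Quotient.mk (Ideal.span {f}) (X 1) ∈ P := hP.1.2 (Ideal.subset_span (Set.mem_insert_of_mem _ rfl))
    have hzP : Ideal.Quotient.mk (Ideal.span {f}) (X 2) ∈ P := by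
      refine hprime.mem_of_pow_mem 2 ?_
      have h0 : Ideal.Quotient.mk (Ideal.span {f}) f = 0 :=
        Ideal.Quotient.eq_zero_iff_mem.mpr (Ideal.mem_span_singleton_self f)
      have h1 := congrArg (Ideal.Quotient.mk (Ideal.span {f})) hf
      simp only [h0, map_add, map_mul, map_pow] at h1
      have h2 : ∀ {A : Type u} [CommRing A] {x y z u a b : A},
          0 = z ^ 2 + u * (x * y * z) + x ^ 2 * a + y ^ 2 * b →
            z ^ 2 = -(u * y * z + x * a) * x + -(y * b) * y := fun h => by
        linear_combination -h
      rw [h2 h1]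
      exact add_mem (Ideal.mul_mem_left _ _ hxP) (Ideal.mul_mem_left _ _ hyP)
    have h3 : (3 : ℕ∞) ≤ (P.comap (Ideal.Quotient.mk (Ideal.span {f}))).height := by
      refine card_le_height (s := {0, 1, 2}) fun i hi => ?_
      fin_cases hi
      exacts [hxP, hyP, hzP]
    have h4 := Ideal.height_le_height_add_one_of_mem (r := f)
      (p := P.comap (Ideal.Quotient.mk (Ideal.span {f})))
      (by
        rw [Ideal.mem_comap, Ideal.Quotient.eq_zero_iff_mem.mpr (Ideal.mem_span_singleton_self f)]
        exact zero_mem _)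
    rw [Ideal.map_comap_of_surjective _ Ideal.Quotient.mk_surjective] at h4
    exact (ENat.add_le_add_iff_right ENat.one_ne_top).mp
      ((show (2 : ℕ∞) + 1 = 3 by norm_num) ▸ h3.trans h4)

end MvPolynomial

open MvPolynomial in
theorem proposition4p2 (k : Type u) [Field k] [IsAlgClosed k] [CharP k 2]
    (t : CDVType) (f : MvPolynomial (Fin 4) k)
    (hf : IsDefiningPolynomial (MvPolynomial.X 0) (MvPolynomial.X 1) (MvPolynomial.X 2)
      (MvPolynomial.X 3) t f) :
    (IsFPure 2 (MvPolynomial (Fin 4) k ⧸ Ideal.span {f}) ↔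
      t = .E 7 3 ∨ t = .DB 4 1 1 ∨ t = .DB 4 1 2 ∨ t = .DC 5 1 3 ∨
      ∃ n : ℕ, 3 ≤ n ∧
        (t = .DB (2 * n) (n - 1) (n - 1) ∨ t = .DB (2 * n) (n - 1) n ∨
          t = .DC (2 * n) (n - 1) (2 * n - 2) ∨
          t = .DB (2 * n + 1) (n - 1) (n - 1) ∨ t = .DC (2 * n + 1) (n - 1) (2 * n - 1))) ∧
    ¬ IsFRational 2 (MvPolynomial (Fin 4) k ⧸ Ideal.span {f}) := by
  change (_ ↔ t.IsPureLabel) ∧ _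
  have h0 : Ideal.Quotient.mk (Ideal.span {f}) f = 0 :=
    Ideal.Quotient.eq_zero_iff_mem.mpr (Ideal.mem_span_singleton_self f)
  -- The argument against `F`-rationality is uniform in `u`; it is applied below with `u = 0` and `u
  -- = 1`.
  have key : ∀ u a b : MvPolynomial (Fin 4) k,
      f = X 2 ^ 2 + u * (X 0 * X 1 * X 2) + X 0 ^ 2 * a + X 1 ^ 2 * b →
      Nontrivial (MvPolynomial (Fin 4) k ⧸ Ideal.span {f}) ∧
        ¬ IsFRational 2 (MvPolynomial (Fin 4) k ⧸ Ideal.span {f}) := by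
    intro u a b h
    have hnt : Nontrivial (MvPolynomial (Fin 4) k ⧸ Ideal.span {f}) :=
      nontrivial_of_ne (Ideal.Quotient.mk _ (X 2)) 0 fun h1 =>
        mk_X_two_notMem_span h (by rw [h1]; exact zero_mem _)
    have : CharP (MvPolynomial (Fin 4) k ⧸ Ideal.span {f}) 2 :=
      charP_of_injective_algebraMap
        (algebraMap k (MvPolynomial (Fin 4) k ⧸ Ideal.span {f})).injective 2
    have h1 := congrArg (Ideal.Quotient.mk (Ideal.span {f})) h
    simp only [h0, map_add, map_mul, map_pow] at h1
    exact ⟨hnt, not_isFRational_of_span_pair h1.symm (mk_X_zero_mem_nonZeroDivisors h)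
      (mk_X_two_notMem_span h) (height_span_mk_X h)⟩
  rcases hf.normal_form frobeniusTrace (fun _ _ _ _ => frobeniusTrace_X_pow_eq_zero) with
    ⟨ht, a, b, h⟩ | ⟨ht, hT, a, b, h⟩
  · have h' : f = X 2 ^ 2 + 0 * (X 0 * X 1 * X 2) + X 0 ^ 2 * a + X 1 ^ 2 * b := by
      rw [h, zero_mul, add_zero]
    refine ⟨iff_of_false ?_ ht, (key 0 a b h').2⟩
    have h1 := congrArg (Ideal.Quotient.mk (Ideal.span {f})) h
    simp only [h0, map_add, map_mul, map_pow] at h1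
    exact not_isFPure_of_sq_mem h1.symm (mk_X_two_notMem_span h')
  · obtain ⟨_, hrat⟩ := key 1 a b (by rw [h, one_mul])
    exact ⟨iff_of_true (isFPure_quotient_of_frobeniusTrace (hT.trans frobeniusTrace_X_mul)) ht,
      hrat⟩
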